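/- Let $N\ge 1$, $K>0$ and $\Omega_1,\dots,\Omega_N\in\mathbb R$. For $\theta\in\mathbb R$ let $\bar\theta\in(-\pi,\pi]$ be its representative modulo $2\pi$, and let $h(\theta)=\sin\theta/|\bar\theta|$ if $\bar\theta\neq 0$ and $h(\theta)=0$ if $\bar\theta=0$ (the critical singular kernel $\sin\theta/|\bar\theta|^{2\alpha}$ with $\alpha=\tfrac12$). Let $H:\mathbb R^N\to\mathbb R^N$, $$H_i(\Theta)=\Omega_i+\frac KN\sum_{j=1}^N h(\theta_j-\theta_i),$$ and let $$\mathcal H(\Theta)=\bigcap_{\delta>0}\ \bigcap_{|\mathcal N|=0}\overline{\mathrm{co}}\bigl(H(B_\delta(\Theta)\setminus\mathcal N)\bigr)$$ be its Filippov set-valued map, where the second intersection is over all Lebesgue-negligible sets $\mathcal N$. Let $\Theta=(\theta_1,\dots,\theta_N):[0,\infty)\to\mathbb R^N$ be a global-in-time Filippov solution of $\dot\Theta=H(\Theta)$, that is, $\Theta$ is absolutely continuous on every $[0,T]$ and $\dot\Theta(t)\in\mathcal H(\Theta(t))$ for almost every $t\ge 0$. Let $t^*\ge 0$ be a collision time,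 i.e. $\bar\theta_i(t^*)=\bar\theta_j(t^*)$ for some $i\ne j$, and let $E\subseteq\{1,\dots,N\}$ be a cluster at time $t^*$, i.e. an equivalence class of the relation $i\sim j\iff\bar\theta_i(t^*)=\bar\theta_j(t^*)$. Let $n=\#E$. Then the following three assertions are equivalent. 1. The oscillators of $E$ stick all together at time $t^*$: $\bar\theta_i(s)=\bar\theta_j(s)$ for all $i,j\in E$ and all $s\ge t^*$. 2. There exist a bijection $\sigma:\{1,\dots,n\}\to E$ and a skew-symmetric matrix $Y\in\mathbb R^{n\times n}$ with entries in $[-1,1]$ such that $$\bigl(\Omega_{\sigma(i)}-\Omega_{\sigma(j)}\bigr)_{1\le i,j\le n}=\frac KN\,(YJ+JY),$$ where $J$ is the $n\times n$ matrix whose entries are all equal to $1$. 3. For every $1\le m\le n$ and every $I\subseteq E$ with $\#I=m$, $$\frac1m\sum_{i\in I}\Omega_i-\frac1n\sum_{i\in E}\Omega_i\in\left[-\frac KN(n-m),\ \frac KN(n-m)\right].$$ -/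

import Mathlib

namespace SingularKuramoto

/-- The representative `θ̄ ∈ (-π, π]` of the phase `θ` modulo `2π`. -/
noncomputable def phaseRep (θ : ℝ) : ℝ :=
  toIocMod Real.two_pi_pos (-Real.pi) θ

/-- The singular interaction kernel `h(θ) = sin θ / |θ|ₒ ^ (2α)`, where `|θ|ₒ = |θ̄|` is the
orthodromic distance to zero. The convention `x / 0 = 0` gives `h = 0` on `2πℤ` when `α ≠ 0`; in
particular an oscillator exerts no force on itself. -/
noncomputable def kernel (α θ : ℝ) : ℝ :=
  Real.sin θ / |phaseRep θ| ^ (2 * α)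

/-- The vector field `H_i(Θ) = Ω_i + (K/N) ∑_j h(θ_j - θ_i)` of the singular weighted
Kuramoto model. -/
noncomputable def vectorField {N : ℕ} (α K : ℝ) (Ω : Fin N → ℝ)
    (Θ : EuclideanSpace ℝ (Fin N)) : EuclideanSpace ℝ (Fin N) :=
  WithLp.toLp 2 fun i => Ω i + K / (N : ℝ) * ∑ j, kernel α (Θ j - Θ i)

/-- The Filippov set-valued map of a vector field `F`: the intersection, over all `δ > 0` and all
Lebesgue-negligible sets `Z`, of the closed convex hull of `F (B_δ(x) \ Z)`. -/
def filippovMap {N : ℕ} (F : EuclideanSpace ℝ (Fin N) → EuclideanSpace ℝ (Fin N))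
    (x : EuclideanSpace ℝ (Fin N)) : Set (EuclideanSpace ℝ (Fin N)) :=
  ⋂ (δ : ℝ) (_ : 0 < δ) (Z : Set (EuclideanSpace ℝ (Fin N))) (_ : MeasureTheory.volume Z = 0),
    closure (convexHull ℝ (F '' (Metric.ball x δ \ Z)))

/-- `Θ` is a global-in-time Filippov solution (on `[0, ∞)`) of `x' = F(x)`: it is absolutely
continuous on every `[0, T]` and satisfies the differential inclusion `x' ∈ 𝓕(x)` for almost
every `t ≥ 0`. -/
structure IsFilippovSolution {N : ℕ} (F : EuclideanSpace ℝ (Fin N) → EuclideanSpace ℝ (Fin N))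
    (Θ : ℝ → EuclideanSpace ℝ (Fin N)) : Prop where
  absolutelyContinuous : ∀ T : ℝ, 0 ≤ T → AbsolutelyContinuousOnInterval Θ 0 T
  inclusion : ∀ᵐ t ∂(MeasureTheory.volume.restrict (Set.Ici (0 : ℝ))),
    ∃ v ∈ filippovMap F (Θ t), HasDerivAt Θ v t

/-- The oscillators `i` and `j` collide in the configuration `Θ`: their phases agree
modulo `2π`. -/
def Collide {N : ℕ} (Θ : EuclideanSpace ℝ (Fin N)) (i j : Fin N) : Prop :=
  phaseRep (Θ i) = phaseRep (Θ j)

/-- `Θ` is a collision state: some two different oscillators collide. -/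
def IsCollisionState {N : ℕ} (Θ : EuclideanSpace ℝ (Fin N)) : Prop :=
  ∃ i j : Fin N, i ≠ j ∧ Collide Θ i j

open Classical in
/-- The collision class of the `i`-th oscillator. -/
noncomputable def collisionClass {N : ℕ} (Θ : EuclideanSpace ℝ (Fin N)) (i : Fin N) :
    Finset (Fin N) :=
  Finset.univ.filter fun j => Collide Θ i j

/-- `E` is one of the clusters, that is, one of the collision classes, of `Θ`. -/
def IsCluster {N : ℕ} (Θ : EuclideanSpace ℝ (Fin N)) (E : Finset (Fin N)) : Prop :=
  ∃ i : Fin N, E = collisionClass Θ i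

/-- The oscillators with indices in `E` stick all together at time `t` along the trajectory `Θ`:
any two of them collide at all times `s ≥ t`. -/
def StickTogether {N : ℕ} (Θ : ℝ → EuclideanSpace ℝ (Fin N)) (E : Finset (Fin N)) (t : ℝ) : Prop :=
  ∀ i ∈ E, ∀ j ∈ E, ∀ s : ℝ, t ≤ s → Collide (Θ s) i j

/-- The matrix `(Ω_{σ i} - Ω_{σ j})_{i j}` of relative natural frequencies. -/
def relFreqMatrix {N n : ℕ} (Ω : Fin N → ℝ) (σ : Fin n → Fin N) : Matrix (Fin n) (Fin n) ℝ :=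
  Matrix.of fun i j => Ω (σ i) - Ω (σ j)

/-- The `n × n` matrix all of whose entries are one. -/
def onesMatrix (n : ℕ) : Matrix (Fin n) (Fin n) ℝ :=
  Matrix.of fun _ _ => 1

/-- The set of skew-symmetric `n × n` matrices with entries in `[-1, 1]`. -/
def skewUnit (n : ℕ) : Set (Matrix (Fin n) (Fin n) ℝ) :=
  {Y | Y.transpose = -Y ∧ ∀ i j, Y i j ∈ Set.Icc (-1 : ℝ) 1}

end SingularKuramoto

/-!
The critical kernel `h` behaves like the sign function near the collision angles: it jumps upwards
from `-1` to `1` there and is Lipschitz elsewhere. The proof exploits this through the bound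
`|h| ≤ 1`, the continuity of `h` away from `2πℤ`, the monotonicity of `x ↦ h x + 2 x`
(`monotone_kernel_half_add`), which is a one-sided Lipschitz condition, and the bound
`|u| - 2 u ^ 2 ≤ u * h u` (`abs_sub_sq_le_mul_kernel_half`). A linear inequality valid for the vector field near
a point holds for all Filippov velocities at that point (`le_of_mem_filippovMap`), so no finer
description of the Filippov map is needed.

*Sticking implies the bounds on means.* Just after the collision the cluster `E` is separated from
the other oscillators, which therefore act on it by a common continuous force. As the oscillators
of `E` move with one velocity, the difference of mean frequencies over `I` and `E` must be
compensated by the forces of `E \ I` on `I`, each of modulus at most `1`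
(`StickTogether.abs_mean_sub_mean_le`).

*The bounds on means imply the matrix equation.* The equation prescribes the row sums of the
skew-symmetric matrix, and the bounds are a Landau-type criterion for the existence of such a
matrix with entries in `[-1, 1]`, proved by minimizing the distance to the prescribed row sums
(`exists_skew_sum_eq`).

*The matrix equation implies sticking.* The matrix entries balance the natural frequencies in the
evolution of the squared spread `V = ∑ (x i - x j) ^ 2` of `E`. The attraction inside `E` dominates
them up to a Lipschitz error and the one-sided Lipschitz condition controls the force of each other
oscillator, even when it joins the cluster; hence `V' ≤ C V`, and `V` remains zero
(`spread_dissipation`, `stickTogether_of_skew`).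
-/

namespace SingularKuramoto

open Filter Topology MeasureTheory

/-! ### The critical kernel -/

lemma phaseRep_mem (θ : ℝ) : -Real.pi < phaseRep θ ∧ phaseRep θ ≤ Real.pi := by
  have h := toIocMod_mem_Ioc Real.two_pi_pos (-Real.pi) θ
  refine ⟨h.1, h.2.trans (le_of_eq (by ring))⟩

lemma phaseRep_eq_phaseRep_iff {a b : ℝ} :
    phaseRep a = phaseRep b ↔ ∃ n : ℤ, a - b = n * (2 * Real.pi) := by
  rw [eq_comm, phaseRep, phaseRep, toIocMod_eq_toIocMod]
  simp only [zsmul_eq_mul]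

lemma exists_eq_phaseRep_add (θ : ℝ) : ∃ n : ℤ, θ = phaseRep θ + n * (2 * Real.pi) := by
  refine ⟨toIocDiv Real.two_pi_pos (-Real.pi) θ, ?_⟩
  rw [phaseRep, ← self_sub_toIocDiv_zsmul, zsmul_eq_mul]
  ring

lemma cos_phaseRep (θ : ℝ) : Real.cos (phaseRep θ) = Real.cos θ := by
  obtain ⟨n, hn⟩ := exists_eq_phaseRep_add θ
  conv_rhs => rw [hn]
  rw [Real.cos_add_int_mul_two_pi]

lemma sin_phaseRep (θ : ℝ) : Real.sin (phaseRep θ) = Real.sin θ := by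
  obtain ⟨n, hn⟩ := exists_eq_phaseRep_add θ
  conv_rhs => rw [hn]
  rw [Real.sin_add_int_mul_two_pi]

/-- The orthodromic distance as a manifestly continuous, even and periodic function. -/
lemma abs_phaseRep (θ : ℝ) : |phaseRep θ| = Real.arccos (Real.cos θ) := by
  have h := phaseRep_mem θ
  rw [← cos_phaseRep, ← Real.cos_abs, Real.arccos_cos (abs_nonneg _) (abs_le.2 ⟨h.1.le, h.2⟩)]

lemma kernel_half (θ : ℝ) :
    kernel (1 / 2) θ = Real.sin θ / Real.arccos (Real.cos θ) := by
  simp [kernel, abs_phaseRep]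

lemma kernel_half_zero : kernel (1 / 2) 0 = 0 := by rw [kernel_half]; simp

lemma kernel_half_neg (θ : ℝ) : kernel (1 / 2) (-θ) = -kernel (1 / 2) θ := by
  rw [kernel_half, kernel_half, Real.sin_neg, Real.cos_neg, neg_div]

lemma kernel_half_add_int_mul (θ : ℝ) (n : ℤ) :
    kernel (1 / 2) (θ + n * (2 * Real.pi)) = kernel (1 / 2) θ := by
  rw [kernel_half, kernel_half, Real.sin_add_int_mul_two_pi, Real.cos_add_int_mul_two_pi]

lemma kernel_half_phaseRep (θ : ℝ) : kernel (1 / 2) (phaseRep θ) = kernel (1 / 2) θ := by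
  rw [kernel_half, kernel_half, cos_phaseRep, sin_phaseRep]

lemma kernel_half_of_mem {θ : ℝ} (h₁ : 0 ≤ θ) (h₂ : θ ≤ Real.pi) :
    kernel (1 / 2) θ = Real.sin θ / θ := by
  rw [kernel_half, Real.arccos_cos h₁ h₂]

lemma abs_kernel_half_le_one (θ : ℝ) : |kernel (1 / 2) θ| ≤ 1 := by
  rw [kernel_half, ← abs_phaseRep, abs_div, abs_abs, ← sin_phaseRep]
  exact div_le_one_of_le₀ Real.abs_sin_le_abs (abs_nonneg _)

lemma continuousAt_kernel_half {θ : ℝ} (h : Real.cos θ ≠ 1) :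
    ContinuousAt (kernel (1 / 2)) θ := by
  have h' : kernel (1 / 2) = fun θ => Real.sin θ / Real.arccos (Real.cos θ) :=
    funext kernel_half
  rw [h']
  refine Real.continuous_sin.continuousAt.div
    (Real.continuous_arccos.comp Real.continuous_cos).continuousAt ?_
  rw [Ne, Real.arccos_eq_zero]
  exact fun h1 => h (le_antisymm (Real.cos_le_one _) h1)

/-- On `[0, π]` the kernel is `sin x / x`, whose slope is at least `-x / 2`. -/
lemma kernel_half_add_le_of_nonneg {x y : ℝ} (hy : 0 ≤ y) (hyx : y ≤ x) (hx : x ≤ Real.pi) :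
    kernel (1 / 2) y + 2 * y ≤ kernel (1 / 2) x + 2 * x := by
  rcases hyx.eq_or_lt with rfl | hlt
  · exact le_rfl
  have hx0 : 0 < x := hy.trans_lt hlt
  rcases hy.eq_or_lt with rfl | hy0
  · have : 0 ≤ Real.sin x / x := div_nonneg (Real.sin_nonneg_of_nonneg_of_le_pi hx0.le hx) hx0.le
    rw [kernel_half_zero, kernel_half_of_mem hx0.le hx]
    linarith
  rw [kernel_half_of_mem hx0.le hx, kernel_half_of_mem hy (hyx.trans hx)]
  obtain ⟨ξ, hξ, hs⟩ := exists_hasDerivAt_eq_slope Real.sin Real.cos hlt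
    Real.continuous_sin.continuousOn fun t _ => Real.hasDerivAt_sin t
  have hd : 0 < x - y := sub_pos.2 hlt
  rw [eq_div_iff hd.ne'] at hs
  have h1 : 1 - x ^ 2 / 2 ≤ Real.cos ξ := by
    have := Real.one_sub_sq_div_two_le_cos (x := ξ)
    nlinarith [hξ.1, hξ.2]
  have h2 : Real.sin y ≤ y := Real.sin_le hy
  have h3 : (1 - x ^ 2 / 2) * (x - y) ≤ Real.sin x - Real.sin y := by
    rw [← hs]
    exact mul_le_mul_of_nonneg_right h1 hd.le
  have h4 : x ≤ 4 := hx.trans Real.pi_le_four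
  have h5 : Real.sin y / y - Real.sin x / x ≤ 2 * (x - y) := by
    rw [div_sub_div _ _ hy0.ne' hx0.ne', div_le_iff₀ (mul_pos hy0 hx0)]
    calc Real.sin y * x - y * Real.sin x
        = (x - y) * Real.sin y - y * (Real.sin x - Real.sin y) := by ring
      _ ≤ (x - y) * y - y * ((1 - x ^ 2 / 2) * (x - y)) := by gcongr
      _ = (x / 2) * ((x - y) * (y * x)) := by ring
      _ ≤ 2 * ((x - y) * (y * x)) := by gcongr; linarith
      _ = 2 * (x - y) * (y * x) := by ring
  linarith

lemma kernel_half_add_le_of_mem {x y : ℝ} (hy : -Real.pi ≤ y) (hyx : y ≤ x)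
    (hx : x ≤ Real.pi) :
    kernel (1 / 2) y + 2 * y ≤ kernel (1 / 2) x + 2 * x := by
  have hneg : ∀ {x y : ℝ}, -Real.pi ≤ y → y ≤ x → x ≤ 0 →
      kernel (1 / 2) y + 2 * y ≤ kernel (1 / 2) x + 2 * x := fun {x y} h₁ h₂ h₃ => by
    have := kernel_half_add_le_of_nonneg (neg_nonneg.2 h₃) (neg_le_neg h₂) (by linarith)
    rw [kernel_half_neg, kernel_half_neg] at this
    linarith
  rcases le_total 0 y with h0 | h0
  · exact kernel_half_add_le_of_nonneg h0 hyx hx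
  rcases le_total x 0 with h1 | h1
  · exact hneg hy hyx h1
  exact (hneg hy h0 le_rfl).trans (kernel_half_add_le_of_nonneg le_rfl h1 hx)

/-- The kernel is one-sided Lipschitz: it is smooth apart from upward jumps at `2πℤ`. -/
lemma monotone_kernel_half_add : Monotone fun x : ℝ => kernel (1 / 2) x + 2 * x := by
  intro y x hyx
  obtain ⟨k, hk⟩ := exists_eq_phaseRep_add y
  obtain ⟨l, hl⟩ := exists_eq_phaseRep_add x
  have hy := phaseRep_mem y
  have hx := phaseRep_mem x
  have hpi := Real.pi_pos
  simp only
  rw [← kernel_half_phaseRep y, ← kernel_half_phaseRep x]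
  rcases lt_trichotomy k l with h | h | h
  -- Different periods are compared through the point `π ≡ -π` between them, where `h = 0`.
  · have h1 := kernel_half_add_le_of_mem hy.1.le hy.2 le_rfl
    have h2 := kernel_half_add_le_of_mem le_rfl hx.1.le hx.2
    have h3 : kernel (1 / 2) Real.pi = 0 := by rw [kernel_half]; simp
    rw [h3] at h1
    rw [kernel_half_neg, h3] at h2
    have h4 : (k : ℝ) + 1 ≤ l := by exact_mod_cast h
    nlinarith
  · subst h
    have := kernel_half_add_le_of_mem hy.1.le (by linarith : phaseRep y ≤ phaseRep x) hx.2
    linarith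
  · have h4 : (l : ℝ) + 1 ≤ k := by exact_mod_cast h
    nlinarith

lemma neg_two_mul_sq_le_mul_kernel_half_sub (a b : ℝ) :
    -(2 * (a - b) ^ 2) ≤ (a - b) * (kernel (1 / 2) a - kernel (1 / 2) b) := by
  rcases le_total a b with h | h
  · have := monotone_kernel_half_add h
    simp only at this
    nlinarith
  · have := monotone_kernel_half_add h
    simp only at this
    nlinarith

/-- Near `0` the kernel is the sign function up to a Lipschitz error. -/
lemma abs_sub_sq_le_mul_kernel_half (u : ℝ) :
    |u| - 2 * u ^ 2 ≤ u * kernel (1 / 2) u := by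
  wlog hu : 0 ≤ u generalizing u
  · have := this (-u) (by linarith)
    rw [kernel_half_neg, abs_neg] at this
    linarith
  rw [abs_of_nonneg hu]
  rcases hu.eq_or_lt with rfl | hu0
  · simp
  rcases le_total u 1 with h1 | h1
  · rw [kernel_half_of_mem hu (h1.trans (by linarith [Real.pi_gt_three])),
      mul_div_cancel₀ _ hu0.ne']
    have := Real.sin_gt_sub_cube hu0
    nlinarith [mul_nonneg (sq_nonneg u) (sub_nonneg.2 h1), sq_nonneg u]
  · have := (abs_le.1 (abs_kernel_half_le_one u)).1
    nlinarith

/-! ### Filippov velocities and Grönwall's inequality -/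

/-- A linear inequality satisfied by the field near `x` is satisfied by every Filippov velocity
at `x`, because half-spaces are closed and convex. -/
lemma le_of_mem_filippovMap {N : ℕ} {F : EuclideanSpace ℝ (Fin N) → EuclideanSpace ℝ (Fin N)}
    {x v : EuclideanSpace ℝ (Fin N)} (hv : v ∈ filippovMap F x)
    (l : EuclideanSpace ℝ (Fin N) →L[ℝ] ℝ) {b : ℝ} (h : ∀ᶠ y in 𝓝 x, l (F y) ≤ b) :
    l v ≤ b := by
  obtain ⟨δ, hδ, hb⟩ := Metric.eventually_nhds_iff_ball.1 h
  simp only [filippovMap, Set.mem_iInter] at hv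
  have hv' := hv δ hδ ∅ measure_empty
  refine closure_minimal (convexHull_min ?_ ?_)
    (isClosed_le l.continuous continuous_const : IsClosed {w | l w ≤ b}) hv'
  · rintro _ ⟨y, hy, rfl⟩
    exact hb y hy.1
  · exact convex_halfSpace_le l.toLinearMap.isLinear b

/-- Grönwall's inequality for absolutely continuous functions, with initial value `0`. -/
lemma nonpos_of_ae_deriv_le_mul {V : ℝ → ℝ} {C a b : ℝ} (hab : a ≤ b)
    (hV : AbsolutelyContinuousOnInterval V a b) (ha : V a = 0)
    (h : ∀ᵐ t, t ∈ Set.Icc a b → deriv V t ≤ C * V t) : V b ≤ 0 := by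
  have hexp : AbsolutelyContinuousOnInterval (fun t : ℝ => Real.exp (-C * t)) a b :=
    ContDiffOn.absolutelyContinuousOnInterval (by fun_prop)
  have hW := hexp.fun_mul hV
  have hint := hW.integral_deriv_eq_sub
  have hnonneg : 0 ≤ ∫ t in a..b, -deriv (fun t => Real.exp (-C * t) * V t) t := by
    refine intervalIntegral.integral_nonneg_of_ae_restrict hab ?_
    rw [EventuallyLE, ae_restrict_iff' measurableSet_Icc]
    filter_upwards [h, hV.ae_differentiableAt] with t h₁ h₂ ht
    have hd := (h₂ (by rwa [Set.uIcc_of_le hab])).hasDerivAt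
    have he : HasDerivAt (fun t : ℝ => Real.exp (-C * t)) (Real.exp (-C * t) * -C) t := by
      simpa using ((hasDerivAt_id t).const_mul (-C)).exp
    rw [(he.fun_mul hd).deriv]
    have := mul_le_mul_of_nonneg_left (h₁ ht) (Real.exp_pos (-C * t)).le
    simp only [Pi.zero_apply]
    linarith
  rw [intervalIntegral.integral_neg, hint, ha] at hnonneg
  have := Real.exp_pos (-C * b)
  by_contra! hb
  have := mul_pos this hb
  linarith

/-! ### Skew-symmetric matrices with prescribed row sums -/

lemma sum_sum_eq_zero_of_skew {ι : Type*} (I : Finset ι) {A : ι → ι → ℝ}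
    (hA : ∀ i j, A j i = -A i j) : ∑ i ∈ I, ∑ j ∈ I, A i j = 0 := by
  have h : ∑ i ∈ I, ∑ j ∈ I, A i j = -∑ i ∈ I, ∑ j ∈ I, A i j := by
    conv_lhs => rw [Finset.sum_comm]
    simp only [← Finset.sum_neg_distrib, ← hA]
  linarith

/-- A Landau-type criterion for the row sums of a skew-symmetric matrix with entries in `[-1, 1]`.
The matrix is one whose row sums are closest to the prescribed ones: where the residual is maximal
all the entries towards smaller residuals must be saturated, so the criterion for the set of
indices of maximal residual forces this maximum to be nonpositive. -/
theorem exists_skew_sum_eq {ι : Type*} [Fintype ι] (r : ι → ℝ)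
    (h0 : ∑ i, r i = 0)
    (h : ∀ I : Finset ι, I.Nonempty →
      ∑ i ∈ I, r i ≤ (I.card : ℝ) * ((Fintype.card ι : ℝ) - I.card)) :
    ∃ Y : ι → ι → ℝ, (∀ i j, Y j i = -Y i j) ∧ (∀ i j, Y i j ∈ Set.Icc (-1 : ℝ) 1) ∧
      ∀ i, ∑ j, Y i j = r i := by
  classical
  rcases isEmpty_or_nonempty ι with hι | hι
  · exact ⟨fun _ _ => 0, fun i => isEmptyElim i, fun i => isEmptyElim i, fun i => isEmptyElim i⟩
  set S : Set (ι → ι → ℝ) :=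
    (Set.univ.pi fun _ => Set.univ.pi fun _ => Set.Icc (-1 : ℝ) 1) ∩
      {Y | ∀ i j, Y j i = -Y i j} with hS
  have hcomp : IsCompact S := by
    refine (isCompact_univ_pi fun _ => isCompact_univ_pi fun _ => isCompact_Icc).inter_right ?_
    simp only [Set.ofPred_forall]
    exact isClosed_iInter fun i => isClosed_iInter fun j =>
      isClosed_eq (by fun_prop) (by fun_prop)
  have hne : S.Nonempty := ⟨fun _ _ => 0, fun _ _ _ _ => by norm_num, fun _ _ => by simp⟩
  obtain ⟨Y, hY, hmin⟩ := hcomp.exists_isMinOn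
    (f := fun Y => ∑ a, (r a - ∑ b, Y a b) ^ 2) hne (by fun_prop)
  have hskew : ∀ i j, Y j i = -Y i j := hY.2
  have hbd : ∀ i j, Y i j ∈ Set.Icc (-1 : ℝ) 1 := fun i j => hY.1 i trivial j trivial
  set e : ι → ℝ := fun i => r i - ∑ j, Y i j with he
  have hsat : ∀ i j, e j < e i → Y i j = 1 := by
    intro i j hij
    by_contra hne1
    have hij' : i ≠ j := by rintro rfl; exact lt_irrefl _ hij
    have hlt : Y i j < 1 := lt_of_le_of_ne (hbd i j).2 hne1
    -- Raising the entry `(i, j)` by `t` changes the objective by `2 t ^ 2 - 2 t (e i - e j)`.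
    set t : ℝ := min (1 - Y i j) ((e i - e j) / 2) with ht
    have ht0 : 0 < t := lt_min (by linarith) (by linarith)
    have ht1 : t ≤ 1 - Y i j := min_le_left _ _
    have ht2 : t ≤ (e i - e j) / 2 := min_le_right _ _
    set Z : ι → ι → ℝ := fun a b => Y a b + t * ((if a = i then 1 else 0) * (if b = j then 1 else 0)
      - (if a = j then 1 else 0) * (if b = i then 1 else 0)) with hZ
    have hZS : Z ∈ S := by
      refine ⟨fun a _ b _ => ?_, fun a b => ?_⟩
      · have h1 := hbd a b
        have h2 := hbd i j
        have h3 := hskew i j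
        simp only [hZ, Set.mem_Icc] at h1 h2 ⊢
        by_cases hai : a = i
        · subst hai
          by_cases hbj : b = j
          · subst hbj
            simp only [if_true, if_neg hij', if_neg hij'.symm]
            constructor <;> linarith
          · simpa [hbj, hij'] using h1
        · by_cases haj : a = j
          · subst haj
            by_cases hbi : b = i
            · subst hbi
              simp only [if_true, if_neg hij', if_neg hij'.symm]
              constructor <;> linarith
            · simpa [hbi, hij'.symm] using h1
          · simpa [hai, haj] using h1
      · have := hskew a b
        simp only [hZ, this]
        ring
    have hrow : ∀ a, ∑ b, Z a b =
        ∑ b, Y a b + t * ((if a = i then 1 else 0) - (if a = j then 1 else 0)) := by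
      intro a
      simp only [hZ, Finset.sum_add_distrib, ← Finset.mul_sum, Finset.sum_sub_distrib]
      simp
    have hle : ∑ a, (r a - ∑ b, Y a b) ^ 2 ≤ ∑ a, (r a - ∑ b, Z a b) ^ 2 := hmin hZS
    have hexp : ∑ a, (r a - ∑ b, Z a b) ^ 2 =
        ∑ a, (r a - ∑ b, Y a b) ^ 2 + (2 * t ^ 2 - 2 * t * (e i - e j)) := by
      have : ∀ a, (r a - ∑ b, Z a b) ^ 2 = (r a - ∑ b, Y a b) ^ 2 +
          ((if a = i then t ^ 2 - 2 * t * e a else 0) +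
            (if a = j then t ^ 2 + 2 * t * e a else 0)) := by
        intro a
        rw [hrow a, he]
        by_cases hai : a = i
        · subst hai
          simp only [if_true, if_neg hij']
          ring
        · by_cases haj : a = j
          · subst haj
            simp only [if_true, if_neg hai]
            ring
          · simp [hai, haj]
      simp only [this, Finset.sum_add_distrib, Finset.sum_ite_eq', Finset.mem_univ, if_true]
      ring
    rw [hexp] at hle
    nlinarith
  have hsum : ∑ i, e i = 0 := by
    simp only [he, Finset.sum_sub_distrib, h0, sum_sum_eq_zero_of_skew Finset.univ hskew, sub_zero]
  obtain ⟨i₀, -, hi₀⟩ := Finset.exists_max_image Finset.univ e Finset.univ_nonempty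
  set I : Finset ι := Finset.univ.filter fun i => e i = e i₀ with hI
  have hIne : I.Nonempty := ⟨i₀, by simp [hI]⟩
  have hrows : ∑ i ∈ I, ∑ j, Y i j = (I.card : ℝ) * ((Fintype.card ι : ℝ) - I.card) := by
    have h1 : ∀ i ∈ I, ∑ j, Y i j = ∑ j ∈ I, Y i j + ((Fintype.card ι : ℝ) - I.card) := by
      intro i hi
      have hone : ∀ j ∈ Iᶜ, Y i j = 1 := by
        intro j hj
        simp only [hI, Finset.mem_compl, Finset.mem_filter, Finset.mem_univ, true_and] at hi hj
        exact hsat i j (hi ▸ lt_of_le_of_ne (hi₀ j (Finset.mem_univ j)) hj)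
      rw [← Finset.sum_add_sum_compl I, Finset.sum_congr rfl hone, Finset.sum_const,
        Finset.card_compl, nsmul_eq_mul, mul_one, Nat.cast_sub (Finset.card_le_univ I)]
    rw [Finset.sum_congr rfl h1, Finset.sum_add_distrib, sum_sum_eq_zero_of_skew I hskew,
      Finset.sum_const, nsmul_eq_mul, zero_add]
  have hmax : e i₀ ≤ 0 := by
    have h1 : ∑ i ∈ I, e i = I.card * e i₀ := by
      rw [Finset.sum_congr rfl fun i hi => (Finset.mem_filter.1 hi).2, Finset.sum_const,
        nsmul_eq_mul]
    have h2 : ∑ i ∈ I, e i ≤ 0 := by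
      simp only [he, Finset.sum_sub_distrib, hrows]
      linarith [h I hIne]
    have h3 : (0 : ℝ) < I.card := by exact_mod_cast hIne.card_pos
    by_contra! h4
    have := mul_pos h3 h4
    linarith
  have hzero := (Finset.sum_eq_zero_iff_of_nonpos fun i hi => (hi₀ i hi).trans hmax).1 hsum
  refine ⟨Y, hskew, hbd, fun i => ?_⟩
  have := hzero i (Finset.mem_univ i)
  simp only [he] at this
  linarith

/-! ### Collisions and clusters -/

lemma collide_iff_cos {N : ℕ} {Θ : EuclideanSpace ℝ (Fin N)} {i j : Fin N} :
    Collide Θ i j ↔ Real.cos (Θ i - Θ j) = 1 := by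
  rw [Collide, phaseRep_eq_phaseRep_iff, Real.cos_eq_one_iff]
  simp only [eq_comm]

lemma IsCluster.mem_iff {N : ℕ} {Θ : EuclideanSpace ℝ (Fin N)} {E : Finset (Fin N)}
    (hE : IsCluster Θ E) {i : Fin N} (hi : i ∈ E) (j : Fin N) : j ∈ E ↔ Collide Θ i j := by
  obtain ⟨i₀, rfl⟩ := hE
  simp only [collisionClass, Finset.mem_filter, Finset.mem_univ, true_and] at hi ⊢
  rw [Collide] at hi
  rw [Collide, Collide, hi]

lemma IsCluster.nonempty {N : ℕ} {Θ : EuclideanSpace ℝ (Fin N)} {E : Finset (Fin N)}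
    (hE : IsCluster Θ E) : E.Nonempty := by
  obtain ⟨i₀, rfl⟩ := hE
  refine ⟨i₀, ?_⟩
  simp only [collisionClass, Finset.mem_filter, Finset.mem_univ, true_and]
  exact rfl

/-! ### Absolutely continuous trajectories -/

lemma absolutelyContinuousOnInterval_apply {N : ℕ} {Θ : ℝ → EuclideanSpace ℝ (Fin N)} {a b : ℝ}
    (h : AbsolutelyContinuousOnInterval Θ a b) (i : Fin N) :
    AbsolutelyContinuousOnInterval (fun t => Θ t i) a b := by
  rw [absolutelyContinuousOnInterval_iff] at h ⊢
  intro ε hε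
  obtain ⟨δ, hδ, H⟩ := h ε hε
  refine ⟨δ, hδ, fun I hI hI' => (Finset.sum_le_sum fun k _ => ?_).trans_lt (H I hI hI')⟩
  rw [dist_eq_norm, dist_eq_norm]
  exact PiLp.norm_apply_le (Θ (I.2 k).1 - Θ (I.2 k).2) i

lemma absolutelyContinuousOnInterval_const (c a b : ℝ) :
    AbsolutelyContinuousOnInterval (fun _ => c) a b :=
  ContDiffOn.absolutelyContinuousOnInterval contDiffOn_const

lemma absolutelyContinuousOnInterval_sum {ι : Type*} (s : Finset ι) {f : ι → ℝ → ℝ} {a b : ℝ}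
    (h : ∀ i ∈ s, AbsolutelyContinuousOnInterval (f i) a b) :
    AbsolutelyContinuousOnInterval (fun t => ∑ i ∈ s, f i t) a b := by
  classical
  induction s using Finset.induction_on with
  | empty => simpa using absolutelyContinuousOnInterval_const 0 a b
  | insert i s hi ih =>
    simp only [Finset.sum_insert hi]
    exact (h i (Finset.mem_insert_self i s)).fun_add
      (ih fun j hj => h j (Finset.mem_insert_of_mem hj))

/-! ### Balanced clusters stick -/

lemma sum_sum_sub_mul_sub {ι : Type*} (E : Finset ι) (x a : ι → ℝ) :
    ∑ i ∈ E, ∑ j ∈ E, (x i - x j) * (a i - a j) =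
      2 * (E.card * ∑ i ∈ E, x i * a i - (∑ i ∈ E, x i) * ∑ i ∈ E, a i) := by
  have h1 : ∀ i j, (x i - x j) * (a i - a j) =
      x i * a i + x j * a j - x i * a j - x j * a i := fun i j => by ring
  simp only [h1, Finset.sum_sub_distrib, Finset.sum_add_distrib, Finset.sum_const, nsmul_eq_mul,
    ← Finset.mul_sum, ← Finset.sum_mul]
  ring

/-- Dissipation estimate for the spread of a cluster `E` whose relative natural frequencies are
balanced by admissible forces `Z`. The lifts `θ i - c i` of the phases measure the deviation from
the collided state. Forces inside `E` beat the natural frequencies up to a Lipschitz error, and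
each oscillator outside `E` pulls on `E` through a one-sided Lipschitz field. -/
lemma spread_dissipation {N : ℕ} {κ : ℝ} (hκ : 0 ≤ κ) {Ω : Fin N → ℝ} {E : Finset (Fin N)}
    {Z : Fin N → Fin N → ℝ} (hZ : ∀ i j, Z j i = -Z i j) (hZ1 : ∀ i j, |Z i j| ≤ 1)
    (hΩ : ∀ i ∈ E, ∀ j ∈ E, Ω i - Ω j = κ * (∑ k ∈ E, Z i k - ∑ k ∈ E, Z j k))
    {c : Fin N → ℝ} (hc : ∀ i ∈ E, ∀ j ∈ E, ∃ n : ℤ, c i - c j = n * (2 * Real.pi))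
    (θ f : Fin N → ℝ) (hf : ∀ i, f i = Ω i + κ * ∑ k, kernel (1 / 2) (θ k - θ i)) :
    ∑ i ∈ E, ∑ j ∈ E, ((θ i - c i) - (θ j - c j)) * (f i - f j) ≤
      κ * (2 * E.card + 2 * (Eᶜ).card) *
        ∑ i ∈ E, ∑ j ∈ E, ((θ i - c i) - (θ j - c j)) ^ 2 := by
  set x : Fin N → ℝ := fun i => θ i - c i with hx
  set A : Fin N → Fin N → ℝ := fun i k => Z i k + kernel (1 / 2) (θ k - θ i) with hA
  set V : ℝ := ∑ i ∈ E, ∑ j ∈ E, (x i - x j) ^ 2 with hV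
  have hAskew : ∀ i k, A k i = -A i k := by
    intro i k
    simp only [hA]
    rw [hZ i k, ← neg_sub (θ k) (θ i), kernel_half_neg]
    ring
  have hker : ∀ i ∈ E, ∀ j ∈ E, ∀ z : ℝ,
      kernel (1 / 2) (z - θ i) = kernel (1 / 2) (z - θ j - (x i - x j)) := by
    intro i hi j hj z
    obtain ⟨n, hn⟩ := hc i hi j hj
    rw [← kernel_half_add_int_mul (z - θ i) n, ← hn]
    congr 1
    simp only [hx]
    ring
  have hint : ∑ i ∈ E, ∑ j ∈ E, (x i - x j) * (∑ k ∈ E, A i k - ∑ k ∈ E, A j k) ≤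
      2 * E.card * V := by
    rw [sum_sum_sub_mul_sub, sum_sum_eq_zero_of_skew E hAskew]
    have hsym : ∑ i ∈ E, ∑ k ∈ E, (x i - x k) * A i k = 2 * ∑ i ∈ E, x i * ∑ k ∈ E, A i k := by
      have h1 : ∑ i ∈ E, ∑ k ∈ E, x k * A i k = -∑ i ∈ E, ∑ k ∈ E, x i * A i k := by
        rw [Finset.sum_comm]
        simp only [← Finset.sum_neg_distrib]
        refine Finset.sum_congr rfl fun i _ => Finset.sum_congr rfl fun k _ => ?_
        rw [hAskew i k]
        ring
      simp only [sub_mul, Finset.sum_sub_distrib, h1, ← Finset.mul_sum]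
      ring
    have hle : ∑ i ∈ E, ∑ k ∈ E, (x i - x k) * A i k ≤ 2 * V := by
      rw [hV, Finset.mul_sum]
      refine Finset.sum_le_sum fun i hi => ?_
      rw [Finset.mul_sum]
      refine Finset.sum_le_sum fun k hk => ?_
      have h1 := hker i hi k hk (θ k)
      rw [sub_self, zero_sub, kernel_half_neg] at h1
      have h2 := abs_sub_sq_le_mul_kernel_half (x i - x k)
      have h3 : (x i - x k) * Z i k ≤ |x i - x k| := by
        refine (le_abs_self _).trans ?_
        rw [abs_mul]
        exact mul_le_of_le_one_right (abs_nonneg _) (hZ1 i k)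
      simp only [hA, h1]
      linarith
    have h4 : (0 : ℝ) ≤ E.card := Nat.cast_nonneg _
    have h5 := mul_le_mul_of_nonneg_left hle h4
    rw [hsym] at h5
    linarith
  have hext : ∑ i ∈ E, ∑ j ∈ E, (x i - x j) * (∑ k ∈ Eᶜ, kernel (1 / 2) (θ k - θ i) -
      ∑ k ∈ Eᶜ, kernel (1 / 2) (θ k - θ j)) ≤ 2 * (Eᶜ).card * V := by
    rw [hV, Finset.mul_sum]
    refine Finset.sum_le_sum fun i hi => ?_
    rw [Finset.mul_sum]
    refine Finset.sum_le_sum fun j hj => ?_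
    rw [← Finset.sum_sub_distrib, Finset.mul_sum]
    have h1 : ∀ k ∈ Eᶜ, (x i - x j) * (kernel (1 / 2) (θ k - θ i) - kernel (1 / 2) (θ k - θ j)) ≤
        2 * (x i - x j) ^ 2 := by
      intro k _
      have := neg_two_mul_sq_le_mul_kernel_half_sub (θ k - θ j - (x i - x j)) (θ k - θ j)
      rw [hker i hi j hj]
      linarith
    refine (Finset.sum_le_card_nsmul _ _ _ h1).trans (le_of_eq ?_)
    rw [nsmul_eq_mul]
    ring
  have hsplit : ∀ i ∈ E, ∀ j ∈ E, f i - f j = κ * (∑ k ∈ E, A i k - ∑ k ∈ E, A j k) +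
      κ * (∑ k ∈ Eᶜ, kernel (1 / 2) (θ k - θ i) - ∑ k ∈ Eᶜ, kernel (1 / 2) (θ k - θ j)) := by
    intro i hi j hj
    have h1 := hΩ i hi j hj
    rw [hf, hf, ← Finset.sum_add_sum_compl E, ← Finset.sum_add_sum_compl E]
    simp only [hA, Finset.sum_add_distrib]
    linarith
  calc ∑ i ∈ E, ∑ j ∈ E, (x i - x j) * (f i - f j)
      = κ * ∑ i ∈ E, ∑ j ∈ E, (x i - x j) * (∑ k ∈ E, A i k - ∑ k ∈ E, A j k) +
        κ * ∑ i ∈ E, ∑ j ∈ E, (x i - x j) * (∑ k ∈ Eᶜ, kernel (1 / 2) (θ k - θ i) -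
          ∑ k ∈ Eᶜ, kernel (1 / 2) (θ k - θ j)) := by
        simp only [Finset.mul_sum, ← Finset.sum_add_distrib]
        refine Finset.sum_congr rfl fun i hi => Finset.sum_congr rfl fun j hj => ?_
        rw [hsplit i hi j hj]
        ring
    _ ≤ κ * (2 * E.card * V) + κ * (2 * (Eᶜ).card * V) := by gcongr
    _ = κ * (2 * E.card + 2 * (Eᶜ).card) * V := by ring

lemma vectorField_apply {N : ℕ} (α K : ℝ) (Ω : Fin N → ℝ) (Θ : EuclideanSpace ℝ (Fin N))
    (i : Fin N) :
    vectorField α K Ω Θ i = Ω i + K / (N : ℝ) * ∑ j, kernel α (Θ j - Θ i) := rfl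

lemma abs_vectorField_le {N : ℕ} {K : ℝ} (hK : 0 < K) (Ω : Fin N → ℝ)
    (Θ : EuclideanSpace ℝ (Fin N)) (i : Fin N) :
    |vectorField (1 / 2) K Ω Θ i| ≤ |Ω i| + K / N * N := by
  rw [vectorField_apply]
  refine (abs_add_le _ _).trans ?_
  rw [abs_mul, abs_of_nonneg (by positivity : 0 ≤ K / (N : ℝ))]
  gcongr
  refine (Finset.abs_sum_le_sum_abs _ _).trans ?_
  refine (Finset.sum_le_card_nsmul _ _ 1 fun j _ => abs_kernel_half_le_one _).trans ?_
  simp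

/-- The dissipation estimate carries over from the field to its Filippov velocities. -/
lemma spread_dissipation_filippov {N : ℕ} {K : ℝ} (hK : 0 < K) {Ω : Fin N → ℝ}
    {E : Finset (Fin N)} {Z : Fin N → Fin N → ℝ} (hZ : ∀ i j, Z j i = -Z i j)
    (hZ1 : ∀ i j, |Z i j| ≤ 1)
    (hΩ : ∀ i ∈ E, ∀ j ∈ E, Ω i - Ω j = K / N * (∑ k ∈ E, Z i k - ∑ k ∈ E, Z j k))
    {c : Fin N → ℝ} (hc : ∀ i ∈ E, ∀ j ∈ E, ∃ n : ℤ, c i - c j = n * (2 * Real.pi))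
    {x v : EuclideanSpace ℝ (Fin N)} (hv : v ∈ filippovMap (vectorField (1 / 2) K Ω) x) :
    ∑ i ∈ E, ∑ j ∈ E, ((x i - c i) - (x j - c j)) * (v i - v j) ≤
      K / N * (2 * E.card + 2 * (Eᶜ).card) *
        ∑ i ∈ E, ∑ j ∈ E, ((x i - c i) - (x j - c j)) ^ 2 := by
  set C : ℝ := K / N * (2 * E.card + 2 * (Eᶜ).card) with hC
  set l : EuclideanSpace ℝ (Fin N) →L[ℝ] ℝ := ∑ i ∈ E, ∑ j ∈ E,
    ((x i - c i) - (x j - c j)) •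
      (EuclideanSpace.proj (𝕜 := ℝ) i - EuclideanSpace.proj (𝕜 := ℝ) j) with hl
  have hlapp : ∀ w : EuclideanSpace ℝ (Fin N),
      l w = ∑ i ∈ E, ∑ j ∈ E, ((x i - c i) - (x j - c j)) * (w i - w j) := by
    intro w
    simp [hl]
  rw [← hlapp]
  refine le_of_forall_pos_le_add fun ε hε => le_of_mem_filippovMap hv l ?_
  -- The coefficients of `l` are frozen at `x`; the error made by freezing them is controlled
  -- because the field is bounded.
  set B : Fin N → ℝ := fun i => |Ω i| + K / N * N with hB
  set G : EuclideanSpace ℝ (Fin N) → ℝ := fun y =>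
    C * ∑ i ∈ E, ∑ j ∈ E, ((y i - c i) - (y j - c j)) ^ 2 +
      ∑ i ∈ E, ∑ j ∈ E, |(x i - x j) - (y i - y j)| * (B i + B j) with hG
  have hGc : Continuous G := by fun_prop
  have hGx : G x < C * ∑ i ∈ E, ∑ j ∈ E, ((x i - c i) - (x j - c j)) ^ 2 + ε := by
    simp [hG, hε]
  filter_upwards [hGc.continuousAt.eventually_lt continuousAt_const hGx] with y hy
  refine le_trans ?_ hy.le
  rw [hlapp]
  have h1 := spread_dissipation (by positivity : 0 ≤ K / (N : ℝ)) hZ hZ1 hΩ hc y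
    (vectorField (1 / 2) K Ω y) (vectorField_apply (1 / 2) K Ω y)
  have h2 : ∑ i ∈ E, ∑ j ∈ E, ((x i - x j) - (y i - y j)) *
      (vectorField (1 / 2) K Ω y i - vectorField (1 / 2) K Ω y j) ≤
      ∑ i ∈ E, ∑ j ∈ E, |(x i - x j) - (y i - y j)| * (B i + B j) := by
    refine Finset.sum_le_sum fun i _ => Finset.sum_le_sum fun j _ => ?_
    refine (le_abs_self _).trans ?_
    rw [abs_mul]
    gcongr
    exact (abs_sub _ _).trans
      (add_le_add (abs_vectorField_le hK Ω y i) (abs_vectorField_le hK Ω y j))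
  refine le_trans (le_of_eq ?_) (add_le_add h1 h2)
  simp only [← Finset.sum_add_distrib]
  refine Finset.sum_congr rfl fun i _ => Finset.sum_congr rfl fun j _ => ?_
  ring

/-- The spread of a balanced cluster satisfies Grönwall's inequality, so it vanishes for ever. -/
theorem stickTogether_of_skew {N : ℕ} {K : ℝ} (hK : 0 < K) {Ω : Fin N → ℝ}
    {Θ : ℝ → EuclideanSpace ℝ (Fin N)} (hΘ : IsFilippovSolution (vectorField (1 / 2) K Ω) Θ)
    {t₀ : ℝ} (ht₀ : 0 ≤ t₀) {E : Finset (Fin N)} (hE : IsCluster (Θ t₀) E)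
    {Z : Fin N → Fin N → ℝ} (hZ : ∀ i j, Z j i = -Z i j) (hZ1 : ∀ i j, |Z i j| ≤ 1)
    (hΩ : ∀ i ∈ E, ∀ j ∈ E, Ω i - Ω j = K / N * (∑ k ∈ E, Z i k - ∑ k ∈ E, Z j k)) :
    StickTogether Θ E t₀ := by
  have hc : ∀ i ∈ E, ∀ j ∈ E, ∃ n : ℤ, Θ t₀ i - Θ t₀ j = n * (2 * Real.pi) :=
    fun i hi j hj => phaseRep_eq_phaseRep_iff.1 ((hE.mem_iff hi j).1 hj)
  intro i hi j hj s hs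
  set V : ℝ → ℝ := fun t =>
    ∑ i ∈ E, ∑ j ∈ E, ((Θ t i - Θ t₀ i) - (Θ t j - Θ t₀ j)) ^ 2 with hV
  have hac : AbsolutelyContinuousOnInterval Θ t₀ s := by
    refine (hΘ.absolutelyContinuous s (ht₀.trans hs)).mono ?_
    rw [Set.uIcc_of_le hs, Set.uIcc_of_le (ht₀.trans hs)]
    exact Set.Icc_subset_Icc_left ht₀
  have hVac : AbsolutelyContinuousOnInterval V t₀ s := by
    refine absolutelyContinuousOnInterval_sum E fun i _ =>
      absolutelyContinuousOnInterval_sum E fun j _ => ?_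
    have h1 : ∀ i, AbsolutelyContinuousOnInterval (fun t => Θ t i - Θ t₀ i) t₀ s := fun i =>
      (absolutelyContinuousOnInterval_apply hac i).fun_sub
        (absolutelyContinuousOnInterval_const _ _ _)
    have h2 := (h1 i).fun_sub (h1 j)
    simpa only [sq] using h2.fun_mul h2
  have hV0 : V t₀ = 0 := by simp [hV]
  have hVs : V s ≤ 0 := by
    refine nonpos_of_ae_deriv_le_mul
      (C := 2 * (K / N * (2 * E.card + 2 * (Eᶜ).card))) hs hVac hV0 ?_
    have hincl := hΘ.inclusion
    rw [ae_restrict_iff' measurableSet_Ici] at hincl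
    filter_upwards [hincl] with t ht hts
    obtain ⟨v, hv, hd⟩ := ht (ht₀.trans hts.1)
    have hdi : ∀ i, HasDerivAt (fun t => Θ t i - Θ t₀ i) (v i) t := fun i =>
      ((EuclideanSpace.proj (𝕜 := ℝ) i).hasFDerivAt.comp_hasDerivAt t hd).sub_const _
    have hdV : HasDerivAt V (∑ i ∈ E, ∑ j ∈ E,
        2 * (((Θ t i - Θ t₀ i) - (Θ t j - Θ t₀ j)) * (v i - v j))) t := by
      refine HasDerivAt.fun_sum fun i _ => HasDerivAt.fun_sum fun j _ => ?_
      refine (((hdi i).fun_sub (hdi j)).fun_pow 2).congr_deriv ?_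
      norm_num
      ring
    rw [hdV.deriv]
    have := spread_dissipation_filippov hK hZ hZ1 hΩ hc hv
    simp only [← Finset.mul_sum]
    simp only [hV]
    linarith
  have hterm : ((Θ s i - Θ t₀ i) - (Θ s j - Θ t₀ j)) ^ 2 ≤ 0 := by
    refine le_trans ?_ hVs
    refine le_trans ?_ (Finset.single_le_sum (fun i _ => Finset.sum_nonneg fun j _ => sq_nonneg _)
      hi)
    exact Finset.single_le_sum
      (f := fun j => ((Θ s i - Θ t₀ i) - (Θ s j - Θ t₀ j)) ^ 2) (fun j _ => sq_nonneg _) hj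
  have hzero : (Θ s i - Θ t₀ i) - (Θ s j - Θ t₀ j) = 0 := by
    nlinarith
  obtain ⟨n, hn⟩ := hc i hi j hj
  exact phaseRep_eq_phaseRep_iff.2 ⟨n, by linarith⟩

/-! ### Sticking clusters are balanced -/

/-- Two phases that collide during a time interval move with the same velocity. -/
lemma eq_of_hasDerivAt_of_collide {N : ℕ} {Θ : ℝ → EuclideanSpace ℝ (Fin N)}
    {v : EuclideanSpace ℝ (Fin N)} {s : ℝ} (hd : HasDerivAt Θ v s) {i j : Fin N}
    (h : ∀ᶠ t in 𝓝 s, Collide (Θ t) i j) : v i = v j := by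
  have hdi : ∀ i, HasDerivAt (fun t => Θ t i) (v i) s := fun i =>
    (EuclideanSpace.proj (𝕜 := ℝ) i).hasFDerivAt.comp_hasDerivAt s hd
  have h1 := ((hdi i).fun_sub (hdi j)).sin
  have h2 : (fun t => Real.sin (Θ t i - Θ t j)) =ᶠ[𝓝 s] fun _ => 0 := by
    filter_upwards [h] with t ht
    obtain ⟨n, hn⟩ := phaseRep_eq_phaseRep_iff.1 ht
    simpa [hn] using Real.sin_add_int_mul_two_pi 0 n
  have h3 := h1.unique ((hasDerivAt_const s (0 : ℝ)).congr_of_eventuallyEq h2)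
  rw [collide_iff_cos.1 h.self_of_nhds, one_mul] at h3
  linarith

/-- For a trajectory with a Filippov velocity at almost every time, some time at which a cluster
`E` is still separated from the other oscillators has such a velocity. -/
lemma exists_time_of_cluster {N : ℕ}
    {F : EuclideanSpace ℝ (Fin N) → EuclideanSpace ℝ (Fin N)}
    {Θ : ℝ → EuclideanSpace ℝ (Fin N)} (hΘ : IsFilippovSolution F Θ)
    {t₀ : ℝ} (ht₀ : 0 ≤ t₀) {E : Finset (Fin N)} (hE : IsCluster (Θ t₀) E) :
    ∃ s > t₀, (∀ i ∈ E, ∀ k ∉ E, Real.cos (Θ s k - Θ s i) ≠ 1) ∧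
      ∃ v ∈ filippovMap F (Θ s), HasDerivAt Θ v s := by
  have hcont : ContinuousWithinAt Θ (Set.Ioi t₀) t₀ := by
    have h1 := (hΘ.absolutelyContinuous (t₀ + 1) (by linarith)).continuousOn t₀
      (by rw [Set.uIcc_of_le (by linarith)]; exact ⟨ht₀, by linarith⟩)
    rw [Set.uIcc_of_le (by linarith)] at h1
    refine ContinuousWithinAt.mono_of_mem_nhdsWithin h1 ?_
    exact mem_of_superset (Ioo_mem_nhdsGT (by linarith : t₀ < t₀ + 1))
      fun t ht => ⟨ht₀.trans ht.1.le, ht.2.le⟩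
  have hsep : ∀ᶠ s in 𝓝[>] t₀, ∀ i ∈ E, ∀ k ∉ E, Real.cos (Θ s k - Θ s i) ≠ 1 := by
    have h2 : ∀ i k, ∀ᶠ s in 𝓝[>] t₀, i ∈ E → k ∉ E → Real.cos (Θ s k - Θ s i) ≠ 1 := by
      intro i k
      by_cases hi : i ∈ E
      · by_cases hk : k ∈ E
        · exact Eventually.of_forall fun _ _ h => absurd hk h
        have hne : Real.cos (Θ t₀ k - Θ t₀ i) ≠ 1 := fun h =>
          hk ((hE.mem_iff hi k).2 (collide_iff_cos.2 h).symm)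
        have hg : Continuous fun x : EuclideanSpace ℝ (Fin N) => Real.cos (x k - x i) := by
          fun_prop
        have := (hg.continuousAt.comp_continuousWithinAt hcont).eventually_ne hne
        filter_upwards [this] with s hs _ _ using hs
      · exact Eventually.of_forall fun _ h => absurd h hi
    filter_upwards [eventually_all.2 fun i => eventually_all.2 (h2 i)] with s hs i hi k hk
    exact hs i k hi hk
  obtain ⟨u, hu, hsub⟩ := mem_nhdsGT_iff_exists_Ioo_subset.1 hsep
  have hincl := hΘ.inclusion
  rw [ae_restrict_iff' measurableSet_Ici] at hincl
  have hne : (ae (volume.restrict (Set.Ioo t₀ u))).NeBot := by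
    rw [ae_restrict_neBot, Real.volume_Ioo]
    simpa using hu
  have hev : ∀ᵐ s ∂(volume.restrict (Set.Ioo t₀ u)), s ∈ Set.Ioo t₀ u ∧
      ∃ v ∈ filippovMap F (Θ s), HasDerivAt Θ v s := by
    rw [ae_restrict_iff' measurableSet_Ioo]
    filter_upwards [hincl] with s hs hsu
    exact ⟨hsu, hs (ht₀.trans hsu.1.le)⟩
  obtain ⟨s, hs, hv⟩ := hev.exists
  exact ⟨s, hs.1, hsub hs, hv⟩

/-- The forces that `E` exerts on its subset `I` add up to at most the number of pairs of an
element of `I` and an element of `E \ I`. -/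
lemma abs_sum_sum_kernel_half_le {N : ℕ} {E I : Finset (Fin N)} (hI : I ⊆ E)
    (θ : Fin N → ℝ) :
    |∑ i ∈ I, ∑ k ∈ E, kernel (1 / 2) (θ k - θ i)| ≤ I.card * ((E.card : ℝ) - I.card) := by
  have hskew : ∀ i k, kernel (1 / 2) (θ i - θ k) = -kernel (1 / 2) (θ k - θ i) := fun i k => by
    rw [← kernel_half_neg, neg_sub]
  have h1 : ∑ i ∈ I, ∑ k ∈ E, kernel (1 / 2) (θ k - θ i) =
      ∑ i ∈ I, ∑ k ∈ E \ I, kernel (1 / 2) (θ k - θ i) := by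
    simp only [← Finset.sum_sdiff hI, Finset.sum_add_distrib, sum_sum_eq_zero_of_skew I hskew,
      add_zero]
  rw [h1]
  calc |∑ i ∈ I, ∑ k ∈ E \ I, kernel (1 / 2) (θ k - θ i)|
      ≤ ∑ i ∈ I, ∑ k ∈ E \ I, |kernel (1 / 2) (θ k - θ i)| :=
        (Finset.abs_sum_le_sum_abs _ _).trans
          (Finset.sum_le_sum fun i _ => Finset.abs_sum_le_sum_abs _ _)
    _ ≤ ∑ i ∈ I, ∑ k ∈ E \ I, (1 : ℝ) :=
        Finset.sum_le_sum fun i _ => Finset.sum_le_sum fun k _ => abs_kernel_half_le_one _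
    _ = I.card * ((E.card : ℝ) - I.card) := by
        rw [Finset.sum_const, Finset.sum_const, Finset.card_sdiff_of_subset hI, nsmul_eq_mul,
          nsmul_eq_mul, mul_one, Nat.cast_sub (Finset.card_le_card hI)]

/-- Just after `t₀`, the mean velocity of any part `I` of a sticking cluster `E` equals that of
`E`, while the forces from outside `E` act equally on all of `E`. So the forces inside `E`, at most
`E.card - I.card` on average over `I`, compensate the difference of the mean frequencies. -/
theorem StickTogether.abs_mean_sub_mean_le {N : ℕ} {K : ℝ} (hK : 0 < K) {Ω : Fin N → ℝ}
    {Θ : ℝ → EuclideanSpace ℝ (Fin N)} (hΘ : IsFilippovSolution (vectorField (1 / 2) K Ω) Θ)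
    {t₀ : ℝ} (ht₀ : 0 ≤ t₀) {E : Finset (Fin N)} (hE : IsCluster (Θ t₀) E)
    (hst : StickTogether Θ E t₀) {I : Finset (Fin N)} (hI : I ⊆ E) (hIne : I.Nonempty) :
    |1 / (I.card : ℝ) * ∑ i ∈ I, Ω i - 1 / (E.card : ℝ) * ∑ i ∈ E, Ω i| ≤
      K / N * ((E.card : ℝ) - I.card) := by
  obtain ⟨s, hs, hsep, v, hv, hd⟩ := exists_time_of_cluster hΘ ht₀ hE
  have hIpos : (0 : ℝ) < I.card := by exact_mod_cast hIne.card_pos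
  have hEne : E.Nonempty := hIne.mono hI
  have hEpos : (0 : ℝ) < E.card := by exact_mod_cast hEne.card_pos
  obtain ⟨i₀, hi₀⟩ := hEne
  have hvE : ∀ i ∈ E, v i = v i₀ := fun i hi => eq_of_hasDerivAt_of_collide hd
    (by filter_upwards [lt_mem_nhds hs] with t ht using hst i hi i₀ hi₀ t ht.le)
  -- The mean over `I` minus the mean over `E` vanishes on vectors which are constant on `E`.
  set l : EuclideanSpace ℝ (Fin N) →L[ℝ] ℝ :=
    (1 / (I.card : ℝ)) • ∑ i ∈ I, EuclideanSpace.proj (𝕜 := ℝ) i -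
      (1 / (E.card : ℝ)) • ∑ i ∈ E, EuclideanSpace.proj (𝕜 := ℝ) i with hl
  have hlapp : ∀ w : EuclideanSpace ℝ (Fin N),
      l w = 1 / (I.card : ℝ) * ∑ i ∈ I, w i - 1 / (E.card : ℝ) * ∑ i ∈ E, w i := by
    intro w
    simp [hl]
  have hconst : ∀ (w : Fin N → ℝ) (z : ℝ), (∀ i ∈ E, w i = z) →
      1 / (I.card : ℝ) * ∑ i ∈ I, w i - 1 / (E.card : ℝ) * ∑ i ∈ E, w i = 0 := by
    intro w z hw
    rw [Finset.sum_congr rfl hw, Finset.sum_congr rfl fun i hi => hw i (hI hi), Finset.sum_const,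
      Finset.sum_const, nsmul_eq_mul, nsmul_eq_mul]
    field_simp
    ring
  have hlv : l v = 0 := (hlapp v).trans (hconst v _ hvE)
  set d : ℝ := 1 / (I.card : ℝ) * ∑ i ∈ I, Ω i - 1 / (E.card : ℝ) * ∑ i ∈ E, Ω i with hdef
  set κ : ℝ := K / N with hκ
  have hκ0 : 0 ≤ κ := by positivity
  set G : EuclideanSpace ℝ (Fin N) → ℝ := fun y =>
    1 / (I.card : ℝ) * ∑ i ∈ I, ∑ k ∈ Eᶜ, kernel (1 / 2) (y k - y i) -
      1 / (E.card : ℝ) * ∑ i ∈ E, ∑ k ∈ Eᶜ, kernel (1 / 2) (y k - y i) with hG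
  have hGx : G (Θ s) = 0 := by
    refine hconst _ (∑ k ∈ Eᶜ, kernel (1 / 2) (Θ s k - Θ s i₀)) fun i hi =>
      Finset.sum_congr rfl fun k _ => ?_
    obtain ⟨n, hn⟩ := phaseRep_eq_phaseRep_iff.1 (hst i hi i₀ hi₀ s hs.le)
    rw [← kernel_half_add_int_mul (Θ s k - Θ s i) n, ← hn]
    congr 1
    ring
  have hker : ∀ i ∈ E, ContinuousAt (fun y : EuclideanSpace ℝ (Fin N) =>
      ∑ k ∈ Eᶜ, kernel (1 / 2) (y k - y i)) (Θ s) := by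
    intro i hi
    refine tendsto_finsetSum _ fun k hk => ?_
    refine ContinuousAt.comp (f := fun y : EuclideanSpace ℝ (Fin N) => y k - y i)
      (continuousAt_kernel_half (hsep i hi k (Finset.mem_compl.1 hk))) ?_
    fun_prop
  have hGc : ContinuousAt G (Θ s) :=
    (continuousAt_const.mul (tendsto_finsetSum _ fun i hi => hker i (hI hi))).sub
      (continuousAt_const.mul (tendsto_finsetSum _ fun i hi => hker i hi))
  have hF : ∀ y : EuclideanSpace ℝ (Fin N),
      |l (vectorField (1 / 2) K Ω y) - (d + κ * G y)| ≤ κ * ((E.card : ℝ) - I.card) := by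
    intro y
    have h1 : l (vectorField (1 / 2) K Ω y) - (d + κ * G y) =
        κ * (1 / (I.card : ℝ) * ∑ i ∈ I, ∑ k ∈ E, kernel (1 / 2) (y k - y i)) := by
      have h2 : ∑ i ∈ E, ∑ k ∈ E, kernel (1 / 2) (y k - y i) = 0 :=
        sum_sum_eq_zero_of_skew E fun i k => by rw [← kernel_half_neg, neg_sub]
      rw [hlapp]
      simp only [vectorField_apply, ← Finset.sum_add_sum_compl E (fun j => kernel (1 / 2) _),
        Finset.sum_add_distrib, mul_add, ← Finset.mul_sum, h2, hG, hdef, hκ]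
      ring
    rw [h1, abs_mul, abs_of_nonneg hκ0, abs_mul, abs_of_nonneg (by positivity)]
    refine mul_le_mul_of_nonneg_left ?_ hκ0
    rw [one_div, inv_mul_le_iff₀ hIpos]
    exact abs_sum_sum_kernel_half_le hI y
  have hκG : Tendsto (fun y => κ * G y) (𝓝 (Θ s)) (𝓝 0) := by
    have := hGc.tendsto.const_mul κ
    rwa [hGx, mul_zero] at this
  rw [abs_le]
  constructor
  · refine le_of_forall_pos_le_add fun ε hε => ?_
    have h1 : l v ≤ d + κ * ((E.card : ℝ) - I.card) + ε := by
      refine le_of_mem_filippovMap hv l ?_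
      filter_upwards [hκG.eventually_le_const hε] with y hy
      have := (abs_le.1 (hF y)).2
      linarith
    linarith
  · refine le_of_forall_pos_le_add fun ε hε => ?_
    have h1 : (-l) v ≤ -d + κ * ((E.card : ℝ) - I.card) + ε := by
      refine le_of_mem_filippovMap hv (-l) ?_
      filter_upwards [hκG.eventually_const_le (neg_lt_zero.2 hε)] with y hy
      have := (abs_le.1 (hF y)).1
      rw [neg_apply]
      linarith
    rw [neg_apply] at h1
    linarith

/-! ### The algebraic criteria -/

lemma mul_onesMatrix_add_apply {n : ℕ} {Y : Matrix (Fin n) (Fin n) ℝ} (hY : Y ∈ skewUnit n)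
    (i j : Fin n) :
    (Y * onesMatrix n + onesMatrix n * Y) i j = ∑ k, Y i k - ∑ k, Y j k := by
  have h : ∀ k, Y k j = -Y j k := fun k => by
    simpa using congr_fun (congr_fun hY.1 j) k
  simp [onesMatrix, Matrix.mul_apply, h, sub_eq_add_neg]

/-- The matrix criterion, with the matrix extended by zero to all oscillators. -/
lemma exists_skew_of_relFreqMatrix_eq {N : ℕ} {κ : ℝ} {Ω : Fin N → ℝ} {E : Finset (Fin N)}
    (σ : Fin E.card ≃ E) {Y : Matrix (Fin E.card) (Fin E.card) ℝ} (hY : Y ∈ skewUnit E.card)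
    (h : relFreqMatrix Ω (fun i => (σ i : Fin N)) =
      κ • (Y * onesMatrix E.card + onesMatrix E.card * Y)) :
    ∃ Z : Fin N → Fin N → ℝ, (∀ i j, Z j i = -Z i j) ∧ (∀ i j, |Z i j| ≤ 1) ∧
      ∀ i ∈ E, ∀ j ∈ E, Ω i - Ω j = κ * (∑ k ∈ E, Z i k - ∑ k ∈ E, Z j k) := by
  classical
  set Z : Fin N → Fin N → ℝ := fun i j =>
    if hi : i ∈ E then if hj : j ∈ E then Y (σ.symm ⟨i, hi⟩) (σ.symm ⟨j, hj⟩) else 0 else 0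
    with hZ
  have hrow : ∀ i (hi : i ∈ E), ∑ k ∈ E, Z i k = ∑ k, Y (σ.symm ⟨i, hi⟩) k := by
    intro i hi
    rw [← Finset.sum_coe_sort E, ← Equiv.sum_comp σ]
    simp [hZ, hi]
  refine ⟨Z, fun i j => ?_, fun i j => ?_, fun i hi j hj => ?_⟩
  · by_cases hi : i ∈ E <;> by_cases hj : j ∈ E <;> simp only [hZ, hi, hj, dite_true, dite_false,
      neg_zero]
    simpa using congr_fun (congr_fun hY.1 (σ.symm ⟨i, hi⟩)) (σ.symm ⟨j, hj⟩)
  · by_cases hi : i ∈ E <;> by_cases hj : j ∈ E <;> simp only [hZ, hi, hj, dite_true, dite_false,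
      abs_zero, zero_le_one]
    exact abs_le.2 (hY.2 _ _)
  · have := congr_fun (congr_fun h (σ.symm ⟨i, hi⟩)) (σ.symm ⟨j, hj⟩)
    rw [Matrix.smul_apply, mul_onesMatrix_add_apply hY] at this
    rw [hrow i hi, hrow j hj]
    simpa [relFreqMatrix] using this

/-- The bounds on partial means are the Landau-type criterion for the normalized frequencies. -/
lemma exists_relFreqMatrix_eq {N : ℕ} {κ : ℝ} (hκ : 0 < κ) {Ω : Fin N → ℝ}
    {E : Finset (Fin N)} (hEne : E.Nonempty) (σ : Fin E.card ≃ E)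
    (h : ∀ I : Finset (Fin N), I ⊆ E → I.Nonempty →
      1 / (I.card : ℝ) * ∑ i ∈ I, Ω i - 1 / (E.card : ℝ) * ∑ i ∈ E, Ω i ≤
        κ * ((E.card : ℝ) - I.card)) :
    ∃ Y ∈ skewUnit E.card, relFreqMatrix Ω (fun i => (σ i : Fin N)) =
      κ • (Y * onesMatrix E.card + onesMatrix E.card * Y) := by
  set μ : ℝ := 1 / (E.card : ℝ) * ∑ i ∈ E, Ω i with hμ
  have hEpos : (0 : ℝ) < E.card := by exact_mod_cast hEne.card_pos
  have hsum : ∑ i : Fin E.card, κ⁻¹ * (Ω (σ i) - μ) = 0 := by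
    have h1 : ∑ i, Ω (σ i) = ∑ i ∈ E, Ω i := by
      rw [Equiv.sum_comp σ (fun i : E => Ω i), Finset.sum_coe_sort E]
    rw [← Finset.mul_sum, Finset.sum_sub_distrib, h1, Finset.sum_const, Finset.card_univ,
      Fintype.card_fin, nsmul_eq_mul, hμ]
    rw [← mul_assoc, mul_one_div_cancel hEpos.ne', one_mul, sub_self, mul_zero]
  have hle : ∀ I : Finset (Fin E.card), I.Nonempty → ∑ i ∈ I, κ⁻¹ * (Ω (σ i) - μ) ≤
      (I.card : ℝ) * ((Fintype.card (Fin E.card) : ℝ) - I.card) := by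
    intro I hI
    have hIpos : (0 : ℝ) < I.card := by exact_mod_cast hI.card_pos
    have h1 := h (I.map (σ.toEmbedding.trans (Function.Embedding.subtype _)))
      (fun x hx => by
        obtain ⟨i, -, rfl⟩ := Finset.mem_map.1 hx
        exact (σ i).2) (hI.map)
    rw [Finset.card_map, Finset.sum_map] at h1
    simp only [Function.Embedding.trans_apply, Equiv.coe_toEmbedding,
      Function.Embedding.coe_subtype] at h1
    rw [Fintype.card_fin, ← Finset.mul_sum, inv_mul_le_iff₀ hκ, Finset.sum_sub_distrib,
      Finset.sum_const, nsmul_eq_mul]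
    have h2 := mul_le_mul_of_nonneg_left h1 hIpos.le
    have h3 : (I.card : ℝ) * (1 / (I.card : ℝ) * ∑ i ∈ I, Ω (σ i) - μ) =
        ∑ i ∈ I, Ω (σ i) - I.card * μ := by
      field_simp
    rw [h3] at h2
    linarith
  obtain ⟨Y, hskew, hbd, hrow⟩ := exists_skew_sum_eq _ hsum hle
  have hY : Matrix.of Y ∈ skewUnit E.card :=
    ⟨Matrix.ext fun i j => by simpa using hskew i j, hbd⟩
  refine ⟨Matrix.of Y, hY, Matrix.ext fun i j => ?_⟩
  rw [Matrix.smul_apply, mul_onesMatrix_add_apply hY]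
  simp only [Matrix.of_apply, hrow, relFreqMatrix, smul_eq_mul]
  field_simp
  ring

end SingularKuramoto

theorem mainTheorem4 {N : ℕ} (K : ℝ) (hK : 0 < K) (Ω : Fin N → ℝ)
    (Θ : ℝ → EuclideanSpace ℝ (Fin N))
    (hΘ : SingularKuramoto.IsFilippovSolution
      (SingularKuramoto.vectorField (1 / 2) K Ω) Θ)
    (tstar : ℝ) (htstar : 0 ≤ tstar)
    (hcol : SingularKuramoto.IsCollisionState (Θ tstar))
    (E : Finset (Fin N)) (hE : SingularKuramoto.IsCluster (Θ tstar) E) :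
    (SingularKuramoto.StickTogether Θ E tstar ↔
      ∃ σ : Fin E.card ≃ E, ∃ Y ∈ SingularKuramoto.skewUnit E.card,
        SingularKuramoto.relFreqMatrix Ω (fun i => (σ i : Fin N)) =
          (K / (N : ℝ)) • (Y * SingularKuramoto.onesMatrix E.card +
            SingularKuramoto.onesMatrix E.card * Y)) ∧
    (SingularKuramoto.StickTogether Θ E tstar ↔
      ∀ m : ℕ, 1 ≤ m → m ≤ E.card → ∀ I : Finset (Fin N), I ⊆ E → I.card = m →
        1 / (m : ℝ) * ∑ i ∈ I, Ω i - 1 / (E.card : ℝ) * ∑ i ∈ E, Ω i ∈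
          Set.Icc (-(K / (N : ℝ) * ((E.card : ℝ) - (m : ℝ))))
            (K / (N : ℝ) * ((E.card : ℝ) - (m : ℝ)))) := by
  obtain ⟨i₀, -⟩ := hcol
  have hN : (0 : ℝ) < N := by exact_mod_cast i₀.pos
  have h13 := fun hst : SingularKuramoto.StickTogether Θ E tstar =>
    fun (m : ℕ) (hm : 1 ≤ m) (_ : m ≤ E.card) (I : Finset (Fin N)) (hI : I ⊆ E)
      (hIm : I.card = m) => abs_le.1 (hIm ▸ hst.abs_mean_sub_mean_le hK hΘ htstar hE hI
        (Finset.card_pos.1 (by omega)))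
  have h32 := fun h3 => SingularKuramoto.exists_relFreqMatrix_eq (Ω := Ω) (div_pos hK hN)
    hE.nonempty E.equivFin.symm h3
  have h21 : (∃ σ : Fin E.card ≃ E, ∃ Y ∈ SingularKuramoto.skewUnit E.card,
      SingularKuramoto.relFreqMatrix Ω (fun i => (σ i : Fin N)) =
        (K / (N : ℝ)) • (Y * SingularKuramoto.onesMatrix E.card +
          SingularKuramoto.onesMatrix E.card * Y)) →
      SingularKuramoto.StickTogether Θ E tstar := by
    rintro ⟨σ, Y, hY, h⟩
    obtain ⟨Z, hZ, hZ1, hΩ⟩ := SingularKuramoto.exists_skew_of_relFreqMatrix_eq σ hY h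
    exact SingularKuramoto.stickTogether_of_skew hK hΘ htstar hE hZ hZ1 hΩ
  refine ⟨⟨fun hst => ⟨_, h32 fun I hI hIne => ?_⟩, h21⟩, ⟨h13, fun h3 => h21
    ⟨_, h32 fun I hI hIne => ?_⟩⟩⟩
  · exact (h13 hst _ hIne.card_pos (Finset.card_le_card hI) I hI rfl).2
  · exact (h3 _ hIne.card_pos (Finset.card_le_card hI) I hI rfl).2
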